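/- For a distribution $\mathbf{p}=(p_1,\dots,p_k)$ on a finite set let $C(\mathbf{p})=\sum_{i=1}^k p_i^2$ be its collision probability. Consider the following mechanism with parameters $n\ge 0$ (expected number of users), $\varepsilon_{\mathrm{rel}}\in(0,1]$, $\delta\in(0,1]$, $\alpha>0$ and $\beta\in(0,1]$. Put $$r=\Big\lceil 6\Big(\tfrac{e^\alpha+1}{e^\alpha-1}\Big)^2\log\tfrac4\beta\Big\rceil,\quad a=\Big\lceil 8\log\tfrac1\delta\Big\rceil,\quad b=\Big\lceil \tfrac{20}{\varepsilon_{\mathrm{rel}}^2}\Big\rceil,\quad g=ab,\quad m=\tfrac ng .$$ There are $g$ groups of users, arranged in $a$ supergroups $J_1,\dots,J_a$ of $b$ groups each; group $j$ has $N_j\sim\mathrm{Poisson}(m)$ users. A uniformly random hash function $h$ with values in $\{-1,+1\}$ is chosen. Each user $i$, belonging to group $j_i$, draws a salt $s_i$ uniformly from $\{1,\dots,r\}$ and a sample $x_i$ from $\mathbf{p}$, and sends $v_i=h(\langle j_i,s_i,x_i\rangle)$. All these random choices are independent. The server computes $V_j=\sum_{i:\,j_i=j}v_i$ and $C_j=r(V_j^2-m)/m^2$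 for each group $j$, then $\bar C_\ell=\frac1b\sum_{j\in J_\ell}C_j$ for each supergroup $\ell$, and outputs the median $\hat C$ of $\bar C_1,\dots,\bar C_a$. For all $\beta_0<1$ and $\delta_0<1$ there is a constant $K>0$, depending only on $\beta_0$ and $\delta_0$, such that the following holds for every $k$, every distribution $\mathbf{p}$ on $k$ points and every $\varepsilon$. If $0<\alpha\le 1$, $0<\beta\le\beta_0$, $0<\delta\le\delta_0$, $\varepsilon_{\mathrm{rel}}=\varepsilon/C(\mathbf{p})\in(0,1]$ and $$n\ \ge\ K\cdot\frac{C(\mathbf{p})\,\log\frac1\beta\,\log\frac1\delta}{\alpha^2\varepsilon^2},$$ then $|\hat C-C(\mathbf{p})|\le\varepsilon$ with probability at least $1-\delta$. -/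

import Mathlib

open MeasureTheory ProbabilityTheory

/-- The collision probability `C(p) = ∑ i, p_i ^ 2` of a distribution on `k` points. -/
noncomputable def collisionProb {k : ℕ} (p : PMF (Fin k)) : ℝ :=
  ∑ i, (p i).toReal ^ 2

/-- The median of finitely many real numbers `x 0, …, x (a - 1)`: with the values in increasing
order, the mean of the two middle ones (which are the same one if `a` is odd); `0` if `a = 0`. -/
noncomputable def finMedian {a : ℕ} (x : Fin a → ℝ) : ℝ :=
  if h : 0 < a then
    (x (Tuple.sort x ⟨(a - 1) / 2, by omega⟩) + x (Tuple.sort x ⟨a / 2, by omega⟩)) / 2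
  else 0

/-- The parameters of the mechanism: expected number `n` of users, desired relative error `εrel`,
failure probability `δ`, privacy parameters `α` and `β`. -/
structure MechanismParams where
  n : ℝ
  εrel : ℝ
  δ : ℝ
  α : ℝ
  β : ℝ
  n_nonneg : 0 ≤ n
  εrel_pos : 0 < εrel
  εrel_le_one : εrel ≤ 1
  δ_pos : 0 < δ
  δ_le_one : δ ≤ 1
  α_pos : 0 < α
  β_pos : 0 < β
  β_le_one : β ≤ 1

namespace MechanismParams

/-- Number of salts, `6 ((e^α + 1) / (e^α - 1))² log (4 / β)` rounded up to an integer. -/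
noncomputable def r (M : MechanismParams) : ℕ :=
  ⌈6 * ((Real.exp M.α + 1) / (Real.exp M.α - 1)) ^ 2 * Real.log (4 / M.β)⌉₊

/-- Number of supergroups, `8 log (1 / δ)` rounded up to an integer. -/
noncomputable def a (M : MechanismParams) : ℕ := ⌈8 * Real.log (1 / M.δ)⌉₊

/-- Number of groups in each supergroup, `20 / εrel²` rounded up to an integer. -/
noncomputable def b (M : MechanismParams) : ℕ := ⌈20 / M.εrel ^ 2⌉₊

/-- Number of groups. -/
noncomputable def g (M : MechanismParams) : ℕ := M.a * M.b

/-- Expected number of users in each group. -/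
noncomputable def m (M : MechanismParams) : ℝ := M.n / M.g

theorem r_pos (M : MechanismParams) : 0 < M.r := by
  have h1 : 1 < Real.exp M.α := Real.one_lt_exp_iff.mpr M.α_pos
  have h2 : 1 < 4 / M.β := by
    rw [lt_div_iff₀ M.β_pos]
    linarith [M.β_le_one]
  have h3 : 0 < (Real.exp M.α + 1) / (Real.exp M.α - 1) :=
    div_pos (by linarith) (by linarith)
  have h4 : 0 < Real.log (4 / M.β) := Real.log_pos h2
  exact Nat.ceil_pos.mpr (by positivity)

instance (M : MechanismParams) : NeZero M.r := ⟨M.r_pos.ne'⟩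

/-- The groups; `(ℓ, t)` is the `t`-th group of supergroup `ℓ`. -/
abbrev Group (M : MechanismParams) : Type := Fin M.a × Fin M.b

/-- The inputs `⟨j, s, x⟩` (group, salt, sample) of the hash function. -/
abbrev HashInput (M : MechanismParams) (k : ℕ) : Type := M.Group × Fin M.r × Fin k

/-- All the random choices made in one execution of the mechanism with samples in `Fin k`:
the number `N_j` of users in each group `j`; the hash function, with values `±1`; the salt and the
sample of the `i`-th user of each group `j`, where only the users `i < N_j` take part. -/
abbrev Run (M : MechanismParams) (k : ℕ) : Type :=
  (M.Group → ℕ) × (M.HashInput k → ℤˣ) × (M.Group × ℕ → Fin M.r × Fin k)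

/-- The distribution of the random choices: everything is independent, each `N_j` is
`Poisson(m)`, the hash function is uniformly random (its values are independent uniform signs),
the salts are uniform and the samples have distribution `p`. -/
noncomputable def law (M : MechanismParams) {k : ℕ} (p : PMF (Fin k)) : Measure (M.Run k) :=
  (Measure.pi fun _ : M.Group => poissonMeasure M.m.toNNReal).prod
    ((Measure.pi fun _ : M.HashInput k => (PMF.uniformOfFintype ℤˣ).toMeasure).prod
      (Measure.infinitePi fun _ : M.Group × ℕ =>
        (PMF.uniformOfFintype (Fin M.r)).toMeasure.prod p.toMeasure))

variable {M : MechanismParams} {k : ℕ}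

/-- The hash value sent to the server by the `i`-th user of group `j`. -/
def hashValue (ω : M.Run k) (j : M.Group) (i : ℕ) : ℤˣ :=
  ω.2.1 (j, ω.2.2 (j, i))

/-- `V_j`, the sum of the hash values of the users in group `j`. -/
def groupSum (ω : M.Run k) (j : M.Group) : ℤ :=
  ∑ i ∈ Finset.range (ω.1 j), (hashValue ω j i : ℤ)

/-- `C_j`, the estimate from group `j`. -/
noncomputable def groupEstimate (ω : M.Run k) (j : M.Group) : ℝ :=
  M.r * ((groupSum ω j : ℝ) ^ 2 - M.m) / M.m ^ 2

/-- The mean of the estimates from the groups of supergroup `ℓ`. -/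
noncomputable def supergroupEstimate (ω : M.Run k) (ℓ : Fin M.a) : ℝ :=
  1 / M.b * ∑ t : Fin M.b, groupEstimate ω (ℓ, t)

/-- The output of the mechanism. -/
noncomputable def estimate (ω : M.Run k) : ℝ :=
  finMedian fun ℓ : Fin M.a => supergroupEstimate ω ℓ

end MechanismParams

/-! Fix one group and write `τ` for the law of a user's salt and sample, so that `∑ τ{t}² = C/r`.
Given the hash function `h` and the number `n` of users, the signs are i.i.d. with mean `q = ∑ τ{t}
h(t)`. The moments of `V` are therefore polynomials in `q` whose coefficients are falling factorials
of `n`. Poisson averaging turns each falling factorial into a power of `m`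
(`hasSum_descFactorial_poisson`). Over the random hash, `q` is a Rademacher sum with `E q² = C/r`
and `E q⁴ ≤ 3(C/r)²` (`rademacher_moments`).

Hence `E V² = m + m²C/r`, so each `C_j` is unbiased, and `Var C_j ≤ 5C²` once `m ≥ 3r/C`
(`variance_collisionEstimate_le`). The hash input contains the group, so the groups are independent
(`measurePreserving_groupData`). Chebyshev with `b ≥ 20/εrel²` makes each supergroup mean fail with
probability at most `1/4`. By Hoeffding, half of the `a ≥ 8 log(1/δ)` means fail with probability at
most `exp(-a/8) ≤ δ`; otherwise the median is accurate. It remains to see that the bound on `n`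
forces `m = n/(ab) ≥ 3r/C`, which follows by bounding the rounded parameters. -/

/-! ### Moments of sums of independent signs. -/

section SignMoments

variable {Ω : Type*} [MeasurableSpace Ω] {μ : Measure Ω} [IsProbabilityMeasure μ]

lemma integrable_pow_of_abs_le {S : Ω → ℝ} (hS : Measurable S) {B : ℝ} (hB : ∀ ω, |S ω| ≤ B)
    (k : ℕ) : Integrable (fun ω => S ω ^ k) μ := by
  refine Integrable.of_bound (hS.pow_const k).aestronglyMeasurable (B ^ k) (.of_forall fun ω => ?_)
  rw [Real.norm_eq_abs, abs_pow]
  exact pow_le_pow_left₀ (abs_nonneg _) (hB ω) k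

/-- The first four moments of the sum of a bounded random variable and an independent multiple of
a random sign. -/
lemma moments_add_sign {S X : Ω → ℝ} (hS : Measurable S) (hX : Measurable X) {B : ℝ}
    (hB : ∀ ω, |S ω| ≤ B) (hX2 : ∀ ω, X ω ^ 2 = 1) (h : IndepFun S X μ) (w : ℝ) {q : ℝ}
    (hq : ∫ ω, X ω ∂μ = q) :
    (∫ ω, (S ω + w * X ω) ∂μ = ∫ ω, S ω ∂μ + w * q) ∧
    (∫ ω, (S ω + w * X ω) ^ 2 ∂μ = ∫ ω, S ω ^ 2 ∂μ + 2 * w * q * ∫ ω, S ω ∂μ + w ^ 2) ∧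
    (∫ ω, (S ω + w * X ω) ^ 3 ∂μ = ∫ ω, S ω ^ 3 ∂μ + 3 * w * q * ∫ ω, S ω ^ 2 ∂μ
      + 3 * w ^ 2 * ∫ ω, S ω ∂μ + w ^ 3 * q) ∧
    (∫ ω, (S ω + w * X ω) ^ 4 ∂μ = ∫ ω, S ω ^ 4 ∂μ + 4 * w * q * ∫ ω, S ω ^ 3 ∂μ
      + 6 * w ^ 2 * ∫ ω, S ω ^ 2 ∂μ + 4 * w ^ 3 * q * ∫ ω, S ω ∂μ + w ^ 4) := by
  have hXabs : ∀ ω, |X ω| ≤ 1 := fun ω => by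
    rw [← sq_le_one_iff_abs_le_one, hX2]
  have iX : Integrable X μ := by simpa using integrable_pow_of_abs_le (μ := μ) hX hXabs 1
  have iS : Integrable S μ := by simpa using integrable_pow_of_abs_le (μ := μ) hS hB 1
  have iSk := integrable_pow_of_abs_le (μ := μ) hS hB
  have hind : ∀ k : ℕ, IndepFun (fun ω => S ω ^ k) X μ := fun k =>
    h.comp (φ := fun x => x ^ k) (ψ := id) (by fun_prop) measurable_id
  have hm : ∀ k : ℕ, ∫ ω, S ω ^ k * X ω ∂μ = (∫ ω, S ω ^ k ∂μ) * q := fun k => by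
    rw [(hind k).integral_fun_mul_eq_mul_integral (iSk k).1 iX.1, hq]
  have iSX : ∀ k : ℕ, Integrable (fun ω => S ω ^ k * X ω) μ := fun k =>
    (hind k).integrable_mul (iSk k) iX
  have hm1 : ∫ ω, S ω * X ω ∂μ = (∫ ω, S ω ∂μ) * q := by simpa using hm 1
  have iSX1 : Integrable (fun ω => S ω * X ω) μ := by simpa using iSX 1
  refine ⟨?_, ?_, ?_, ?_⟩
  · rw [integral_add iS (iX.const_mul _), integral_const_mul, hq]
  · have : ∀ ω, (S ω + w * X ω) ^ 2 = S ω ^ 2 + 2 * w * (S ω * X ω) + w ^ 2 := fun ω => by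
      linear_combination w ^ 2 * hX2 ω
    simp_rw [this]
    rw [integral_add, integral_add, integral_const_mul, hm1, integral_const]
    · simp; ring
    all_goals fun_prop
  · have : ∀ ω, (S ω + w * X ω) ^ 3 = S ω ^ 3 + 3 * w * (S ω ^ 2 * X ω) + 3 * w ^ 2 * S ω
        + w ^ 3 * X ω := fun ω => by
      linear_combination (3 * w ^ 2 * S ω + w ^ 3 * X ω) * hX2 ω
    simp_rw [this]
    have i3 := iSk 3
    have i2 := iSX 2
    rw [integral_add, integral_add, integral_add, integral_const_mul, integral_const_mul,
      integral_const_mul, hm 2, hq]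
    · ring
    all_goals fun_prop
  · have : ∀ ω, (S ω + w * X ω) ^ 4 = S ω ^ 4 + 4 * w * (S ω ^ 3 * X ω) + 6 * w ^ 2 * S ω ^ 2
        + 4 * w ^ 3 * (S ω * X ω) + w ^ 4 := fun ω => by
      linear_combination (6 * w ^ 2 * S ω ^ 2 + 4 * w ^ 3 * S ω * X ω + w ^ 4 * (X ω ^ 2 + 1))
        * hX2 ω
    simp_rw [this]
    have i4 := iSk 4
    have i2 := iSk 2
    have i3 := iSX 3
    rw [integral_add, integral_add, integral_add, integral_add, integral_const_mul,
      integral_const_mul, integral_const_mul, hm 3, hm1, integral_const]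
    · simp; ring
    all_goals fun_prop

lemma abs_sum_mul_sign_le {Ω ι : Type*} {X : ι → Ω → ℝ} (hX2 : ∀ i ω, X i ω ^ 2 = 1) (w : ι → ℝ)
    (s : Finset ι) (ω : Ω) : |∑ i ∈ s, w i * X i ω| ≤ ∑ i ∈ s, |w i| := by
  refine (Finset.abs_sum_le_sum_abs _ _).trans (Finset.sum_le_sum fun i _ => ?_)
  rw [abs_mul]
  have : |X i ω| ≤ 1 := by rw [← sq_le_one_iff_abs_le_one, hX2]
  exact mul_le_of_le_one_right (abs_nonneg _) this

/-- Second moment and Khinchin-type fourth moment bound for a Rademacher sum. -/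
lemma rademacher_moments {ι : Type*} {X : ι → Ω → ℝ} (hX : ∀ i, Measurable (X i))
    (hX2 : ∀ i ω, X i ω ^ 2 = 1) (hind : iIndepFun X μ) (h0 : ∀ i, ∫ ω, X i ω ∂μ = 0)
    (w : ι → ℝ) (s : Finset ι) :
    ∫ ω, (∑ i ∈ s, w i * X i ω) ^ 2 ∂μ = ∑ i ∈ s, w i ^ 2 ∧
    ∫ ω, (∑ i ∈ s, w i * X i ω) ^ 4 ∂μ ≤ 3 * (∑ i ∈ s, w i ^ 2) ^ 2 := by
  classical
  induction s using Finset.induction_on with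
  | empty => simp
  | insert a s ha ih =>
    -- Weight `1` at `a` makes the sum over `s` independent of `X a` itself rather than of `w a * X
    -- a`.
    have hind' : iIndepFun (fun i ω => (if i = a then 1 else w i) * X i ω) μ :=
      hind.comp (fun i x => (if i = a then 1 else w i) * x) (fun i => by fun_prop)
    have h1 := hind'.indepFun_finsetSum_of_notMem (fun i => (hX i).const_mul _) ha
    have h2 : IndepFun (fun ω => ∑ i ∈ s, w i * X i ω) (X a) μ := by
      convert h1 using 1
      · ext ω
        simp only [Finset.sum_apply]
        refine Finset.sum_congr rfl fun i hi => ?_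
        rw [if_neg (fun h : i = a => ha (h ▸ hi))]
      · ext ω; simp
    obtain ⟨-, m2, -, m4⟩ := moments_add_sign (Finset.measurable_fun_sum _ fun i _ => (hX i).const_mul _)
      (hX a) (abs_sum_mul_sign_le hX2 w s) (hX2 a) h2 (w a) (h0 a)
    simp_rw [Finset.sum_insert ha, add_comm (w a * _)]
    rw [m2, m4, ih.1]
    refine ⟨by ring, ?_⟩
    nlinarith [ih.2, sq_nonneg (w a ^ 2)]

/-- Second and fourth moments of a sum of independent signs with common mean `q`. -/
lemma iid_sign_moments {X : ℕ → Ω → ℝ} (hX : ∀ i, Measurable (X i))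
    (hX2 : ∀ i ω, X i ω ^ 2 = 1) (hind : iIndepFun X μ) {q : ℝ} (hq : ∀ i, ∫ ω, X i ω ∂μ = q)
    (n : ℕ) :
    ∫ ω, (∑ i ∈ Finset.range n, X i ω) ^ 2 ∂μ = n + n * (n - 1) * q ^ 2 ∧
    ∫ ω, (∑ i ∈ Finset.range n, X i ω) ^ 4 ∂μ = n + 3 * (n * (n - 1))
      + (4 * (n * (n - 1)) + 6 * (n * (n - 1) * (n - 2))) * q ^ 2
      + n * (n - 1) * (n - 2) * (n - 3) * q ^ 4 := by
  suffices H : ∫ ω, (∑ i ∈ Finset.range n, X i ω) ∂μ = n * q ∧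
      ∫ ω, (∑ i ∈ Finset.range n, X i ω) ^ 2 ∂μ = n + n * (n - 1) * q ^ 2 ∧
      ∫ ω, (∑ i ∈ Finset.range n, X i ω) ^ 3 ∂μ = n * q + 3 * (n * (n - 1)) * q
        + n * (n - 1) * (n - 2) * q ^ 3 ∧
      ∫ ω, (∑ i ∈ Finset.range n, X i ω) ^ 4 ∂μ = n + 3 * (n * (n - 1))
      + (4 * (n * (n - 1)) + 6 * (n * (n - 1) * (n - 2))) * q ^ 2
      + n * (n - 1) * (n - 2) * (n - 3) * q ^ 4 from ⟨H.2.1, H.2.2.2⟩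
  induction n with
  | zero => simp
  | succ n ih =>
    obtain ⟨i1, i2, i3, i4⟩ := ih
    have h2 : IndepFun (fun ω => ∑ i ∈ Finset.range n, X i ω) (X n) μ := by
      convert hind.indepFun_sum_range_succ hX n using 1
      ext ω; simp
    obtain ⟨m1, m2, m3, m4⟩ := moments_add_sign
      (Finset.measurable_fun_sum _ fun i _ => hX i) (hX n)
      (B := n) (fun ω => by
        simpa using abs_sum_mul_sign_le hX2 (fun _ => 1) (Finset.range n) ω) (hX2 n) h2 1 (hq n)
    simp only [one_mul] at m1 m2 m3 m4
    simp_rw [Finset.sum_range_succ]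
    rw [m1, m2, m3, m4, i1, i2, i3, i4]
    push_cast
    refine ⟨?_, ?_, ?_, ?_⟩ <;> ring

end SignMoments

/-! ### Factorial moments of the Poisson distribution. -/

section Poisson

open scoped NNReal Nat

/-- The first `k` terms vanish; cancelling the falling factorial against `n !` in the others leaves
`r ^ k` times the Poisson series. -/
lemma hasSum_descFactorial_poisson (r : ℝ≥0) (k : ℕ) :
    HasSum (fun n : ℕ => Real.exp (-r) * r ^ n / n ! * (n.descFactorial k : ℝ)) ((r : ℝ) ^ k) := by
  rw [← hasSum_nat_add_iff' k, Finset.sum_eq_zero, sub_zero]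
  · have key := (hasSum_one_poissonMeasure r).mul_left ((r : ℝ) ^ k)
    rw [mul_one] at key
    refine (congrArg (fun f : ℕ → ℝ => HasSum f _) (funext fun n => ?_)).mpr key
    have h : (n ! : ℝ) * ((n + k).descFactorial k : ℝ) = (n + k)! := by
      have := Nat.factorial_mul_descFactorial (Nat.le_add_left k n)
      rw [Nat.add_sub_cancel] at this
      exact_mod_cast this
    rw [← h]
    have h1 : (n ! : ℝ) ≠ 0 := by positivity
    have h2 : ((n + k).descFactorial k : ℝ) ≠ 0 := by
      rw [Nat.cast_ne_zero, Ne, Nat.descFactorial_eq_zero_iff_lt]; omega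
    field_simp
    ring
  · intro n hn
    rw [Nat.descFactorial_eq_zero_iff_lt.2 (Finset.mem_range.1 hn)]
    simp

lemma integrable_descFactorial_poisson (r : ℝ≥0) (k : ℕ) :
    Integrable (fun n : ℕ => (n.descFactorial k : ℝ)) (poissonMeasure r) := by
  rw [integrable_poissonMeasure_iff]
  simpa using (hasSum_descFactorial_poisson r k).summable

lemma integral_descFactorial_poisson (r : ℝ≥0) (k : ℕ) :
    ∫ n, (n.descFactorial k : ℝ) ∂(poissonMeasure r) = (r : ℝ) ^ k := by
  rw [integral_poissonMeasure]
  simpa using (hasSum_descFactorial_poisson r k).tsum_eq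

lemma cast_descFactorial_three (n : ℕ) :
    (n.descFactorial 3 : ℝ) = n * (n - 1) * (n - 2) := by
  rw [← descPochhammer_eval_eq_descFactorial]
  simp [descPochhammer_succ_right, Polynomial.eval_mul]

lemma cast_descFactorial_four (n : ℕ) :
    (n.descFactorial 4 : ℝ) = n * (n - 1) * (n - 2) * (n - 3) := by
  rw [← descPochhammer_eval_eq_descFactorial]
  simp [descPochhammer_succ_right, Polynomial.eval_mul]

lemma integral_poisson_second (r : ℝ≥0) (u : ℝ) :
    ∫ n : ℕ, ((n : ℝ) + n * (n - 1) * u) ∂(poissonMeasure r) = r + r ^ 2 * u := by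
  have h (n : ℕ) : (n : ℝ) + n * (n - 1) * u
      = n.descFactorial 1 + n.descFactorial 2 * u := by
    rw [Nat.cast_descFactorial_two]; simp
  simp_rw [h]
  have i := integrable_descFactorial_poisson r
  rw [integral_add (i 1) ((i 2).mul_const _), integral_mul_const,
    integral_descFactorial_poisson, integral_descFactorial_poisson, pow_one]

lemma integral_poisson_fourth (r : ℝ≥0) (u v : ℝ) :
    ∫ n : ℕ, ((n : ℝ) + 3 * (n * (n - 1))
      + (4 * (n * (n - 1)) + 6 * (n * (n - 1) * (n - 2))) * u
      + n * (n - 1) * (n - 2) * (n - 3) * v) ∂(poissonMeasure r)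
    = r + 3 * r ^ 2 + (4 * r ^ 2 + 6 * r ^ 3) * u + r ^ 4 * v := by
  have h (n : ℕ) : (n : ℝ) + 3 * (n * (n - 1))
      + (4 * (n * (n - 1)) + 6 * (n * (n - 1) * (n - 2))) * u
      + n * (n - 1) * (n - 2) * (n - 3) * v
      = n.descFactorial 1 + (3 + 4 * u) * n.descFactorial 2
        + (6 * u) * n.descFactorial 3 + v * n.descFactorial 4 := by
    rw [Nat.cast_descFactorial_two, cast_descFactorial_three, cast_descFactorial_four]
    simp only [Nat.descFactorial_one]; ring
  simp_rw [h]
  have i1 := integrable_descFactorial_poisson r 1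
  have i2 := integrable_descFactorial_poisson r 2
  have i3 := integrable_descFactorial_poisson r 3
  have i4 := integrable_descFactorial_poisson r 4
  rw [integral_add, integral_add, integral_add, integral_const_mul, integral_const_mul,
    integral_const_mul]
  · simp only [integral_descFactorial_poisson]; ring
  all_goals fun_prop

lemma integrable_natCast_pow_four_poisson (r : ℝ≥0) :
    Integrable (fun n : ℕ => (n : ℝ) ^ 4) (poissonMeasure r) := by
  -- The coefficients 1, 7, 6, 1 are Stirling numbers of the second kind.
  have h (n : ℕ) : (n : ℝ) ^ 4 = n.descFactorial 1 + 7 * n.descFactorial 2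
        + 6 * n.descFactorial 3 + n.descFactorial 4 := by
    rw [Nat.cast_descFactorial_two, cast_descFactorial_three, cast_descFactorial_four]
    simp only [Nat.descFactorial_one]; ring
  simp_rw [h]
  have i1 := integrable_descFactorial_poisson r 1
  have i2 := integrable_descFactorial_poisson r 2
  have i3 := integrable_descFactorial_poisson r 3
  have i4 := integrable_descFactorial_poisson r 4
  fun_prop

end Poisson

/-! ### Accuracy of the median when fewer than half of the values are bad. -/

section Median

/-- If the lower middle value were below `c - ε`, so would be all values before it in the order, at
least half of the total; likewise for the upper middle value and `c + ε`. -/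
lemma abs_finMedian_sub_le {a : ℕ} (ha : 0 < a) (x : Fin a → ℝ) (c ε : ℝ)
    (h : 2 * (Finset.univ.filter fun i => ε < |x i - c|).card < a) :
    |finMedian x - c| ≤ ε := by
  have hmono := Tuple.monotone_sort x
  set σ := Tuple.sort x
  have card_bound (s : Finset (Fin a)) (hs : ∀ i ∈ s, ε < |x (σ i) - c|) :
      s.card ≤ (Finset.univ.filter fun i => ε < |x i - c|).card :=
    Finset.card_le_card_of_injOn σ (fun i hi => by simpa using hs i hi) σ.injective.injOn
  have hlow : c - ε ≤ x (σ ⟨(a - 1) / 2, by omega⟩) := by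
    by_contra! hlt
    have := card_bound (Finset.Iic ⟨(a - 1) / 2, by omega⟩) fun i hi => by
      have := hmono (Finset.mem_Iic.1 hi)
      simp only [Function.comp_apply] at this
      rw [lt_abs]; right; linarith
    rw [Fin.card_Iic] at this
    simp only at this
    omega
  have hhigh : x (σ ⟨a / 2, by omega⟩) ≤ c + ε := by
    by_contra! hlt
    have := card_bound (Finset.Ici ⟨a / 2, by omega⟩) fun i hi => by
      have := hmono (Finset.mem_Ici.1 hi)
      simp only [Function.comp_apply] at this
      rw [lt_abs]; left; linarith
    rw [Fin.card_Ici] at this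
    simp only at this
    omega
  have hmid : x (σ ⟨(a - 1) / 2, by omega⟩) ≤ x (σ ⟨a / 2, by omega⟩) :=
    hmono (show (⟨(a - 1) / 2, _⟩ : Fin a) ≤ ⟨a / 2, _⟩ by
      rw [Fin.mk_le_mk]; omega)
  rw [finMedian, dif_pos ha, abs_le]
  constructor <;> linarith

end Median

/-! ### Mean and variance of the estimate from one group. -/

section GroupModel

open scoped NNReal

instance : MeasurableSingletonClass ℤˣ where
  measurableSet_singleton u := by
    refine ⟨{(u : ℤ)}, .of_discrete, ?_⟩
    ext v
    simp [Units.ext_iff]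

lemma sq_intUnits_cast (u : ℤˣ) : (((u : ℤ) : ℝ)) ^ 2 = 1 := by
  rcases Int.units_eq_one_or u with rfl | rfl <;> simp

lemma integral_uniform_intUnits :
    ∫ u : ℤˣ, ((u : ℤ) : ℝ) ∂(PMF.uniformOfFintype ℤˣ).toMeasure = 0 := by
  rw [PMF.integral_eq_sum]
  simp

/-- Applied with `w t = τ.real {t}`, where the sum is the mean of a user's sign given the hash
function. -/
lemma hash_bias_moments {T : Type*} [Fintype T] (w : T → ℝ) :
    ∫ h : T → ℤˣ, (∑ t, w t * ((h t : ℤ) : ℝ)) ^ 2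
      ∂(Measure.pi fun _ : T => (PMF.uniformOfFintype ℤˣ).toMeasure) = ∑ t, w t ^ 2 ∧
    ∫ h : T → ℤˣ, (∑ t, w t * ((h t : ℤ) : ℝ)) ^ 4
      ∂(Measure.pi fun _ : T => (PMF.uniformOfFintype ℤˣ).toMeasure)
      ≤ 3 * (∑ t, w t ^ 2) ^ 2 := by
  refine rademacher_moments (X := fun t (h : T → ℤˣ) => ((h t : ℤ) : ℝ)) (fun t => .of_discrete)
    (fun t h => sq_intUnits_cast _) ?_ (fun t => ?_) w Finset.univ
  · exact iIndepFun_pi (μ := fun _ : T => (PMF.uniformOfFintype ℤˣ).toMeasure)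
      (X := fun _ u => ((u : ℤ) : ℝ)) fun _ => Measurable.of_discrete.aemeasurable
  · have := (measurePreserving_eval (fun _ : T => (PMF.uniformOfFintype ℤˣ).toMeasure) t).map_eq
    rw [← integral_uniform_intUnits]
    conv_rhs => rw [← this]
    rw [integral_map (measurable_pi_apply t).aemeasurable
      (Measurable.of_discrete (f := fun u : ℤˣ => ((u : ℤ) : ℝ))).aestronglyMeasurable]

variable {T : Type*}

/-- The sum of the hash values of the users in one group. -/
def hashSum (z : ℕ × (T → ℤˣ) × (ℕ → T)) : ℝ :=
  ∑ i ∈ Finset.range z.1, ((z.2.1 (z.2.2 i) : ℤ) : ℝ)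

lemma abs_hashSum_le (z : ℕ × (T → ℤˣ) × (ℕ → T)) : |hashSum z| ≤ z.1 := by
  simpa [hashSum] using abs_sum_mul_sign_le (X := fun i (z : ℕ × (T → ℤˣ) × (ℕ → T)) =>
    ((z.2.1 (z.2.2 i) : ℤ) : ℝ)) (fun i z => sq_intUnits_cast _) (fun _ => 1)
    (Finset.range z.1) z

/-- The unbiased estimate of the collision probability computed from one group, when there are
`r` salts. -/
noncomputable def collisionEstimate (r m : ℝ) (z : ℕ × (T → ℤˣ) × (ℕ → T)) : ℝ :=
  r * (hashSum z ^ 2 - m) / m ^ 2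

lemma collisionEstimate_eq (r m : ℝ) : (collisionEstimate (T := T) r m)
    = fun z => r / m ^ 2 * hashSum z ^ 2 + -(r / m ^ 2 * m) := by
  ext z; rw [collisionEstimate]; ring

variable [Fintype T] [MeasurableSpace T] [MeasurableSingletonClass T]

/-- The randomness of one group: the number of users, the hash function on the inputs of this
group, and the inputs of the users. -/
noncomputable def groupLaw (m : ℝ≥0) (τ : Measure T) :
    Measure (ℕ × (T → ℤˣ) × (ℕ → T)) :=
  (poissonMeasure m).prod
    ((Measure.pi fun _ : T => (PMF.uniformOfFintype ℤˣ).toMeasure).prod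
      (Measure.infinitePi fun _ : ℕ => τ))

instance (m : ℝ≥0) (τ : Measure T) [IsProbabilityMeasure τ] :
    IsProbabilityMeasure (groupLaw m τ) := by
  unfold groupLaw; infer_instance

lemma measurable_hashSum : Measurable (hashSum (T := T)) := by
  refine measurable_from_prod_countable_right fun n => ?_
  refine Finset.measurable_fun_sum (Finset.range n)
    (f := fun i (y : (T → ℤˣ) × (ℕ → T)) => ((y.1 (y.2 i) : ℤ) : ℝ)) fun i _ => ?_
  -- Evaluating a random hash function at a random point is measurable because `T` is finite, so the
  -- product is finite and discrete.
  have h : Measurable fun y : (T → ℤˣ) × T => ((y.1 y.2 : ℤ) : ℝ) := .of_discrete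
  exact h.comp (by fun_prop : Measurable fun y : (T → ℤˣ) × (ℕ → T) => (y.1, y.2 i))

variable (m : ℝ≥0) (τ : Measure T) [IsProbabilityMeasure τ]

lemma integrable_hashSum_pow_four : Integrable (fun z => hashSum z ^ 4) (groupLaw m τ) := by
  have h : Integrable (fun z : ℕ × (T → ℤˣ) × (ℕ → T) => (z.1 : ℝ) ^ 4) (groupLaw m τ) :=
    (integrable_natCast_pow_four_poisson m).comp_fst _
  refine h.mono' (measurable_hashSum.pow_const 4).aestronglyMeasurable (.of_forall fun z => ?_)
  rw [Real.norm_eq_abs, abs_pow]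
  exact pow_le_pow_left₀ (abs_nonneg _) (abs_hashSum_le z) 4

lemma integrable_hashSum_sq : Integrable (fun z => hashSum z ^ 2) (groupLaw m τ) := by
  refine ((integrable_hashSum_pow_four m τ).add (integrable_const 1)).mono'
    (measurable_hashSum.pow_const 2).aestronglyMeasurable (.of_forall fun z => ?_)
  rw [Real.norm_eq_abs, abs_of_nonneg (sq_nonneg _), Pi.add_apply]
  nlinarith [sq_nonneg (hashSum z ^ 2 - 1)]

/-- With the hash function and the count fixed, the signs depend on independent inputs and are
i.i.d. -/
lemma hashSum_moments_of_hash (h : T → ℤˣ) (n : ℕ) :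
    ∫ x, hashSum (n, h, x) ^ 2 ∂(Measure.infinitePi fun _ : ℕ => τ)
      = n + n * (n - 1) * (∑ t, τ.real {t} * ((h t : ℤ) : ℝ)) ^ 2 ∧
    ∫ x, hashSum (n, h, x) ^ 4 ∂(Measure.infinitePi fun _ : ℕ => τ)
      = n + 3 * (n * (n - 1))
      + (4 * (n * (n - 1)) + 6 * (n * (n - 1) * (n - 2)))
        * (∑ t, τ.real {t} * ((h t : ℤ) : ℝ)) ^ 2
      + n * (n - 1) * (n - 2) * (n - 3) * (∑ t, τ.real {t} * ((h t : ℤ) : ℝ)) ^ 4 := by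
  refine iid_sign_moments (X := fun i (x : ℕ → T) => ((h (x i) : ℤ) : ℝ)) (fun i => ?_)
    (fun i x => sq_intUnits_cast _) ?_ (fun i => ?_) n
  · exact (Measurable.of_discrete (f := fun t => ((h t : ℤ) : ℝ))).comp (measurable_pi_apply i)
  · exact iIndepFun_infinitePi (P := fun _ : ℕ => τ) (X := fun _ t => ((h t : ℤ) : ℝ))
      fun _ => .of_discrete
  · have := (measurePreserving_eval_infinitePi (fun _ : ℕ => τ) i).map_eq
    have e := integral_fintype (μ := τ) (f := fun t => ((h t : ℤ) : ℝ)) .of_finite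
    simp only [smul_eq_mul] at e
    rw [← e]
    conv_rhs => rw [← this]
    rw [integral_map (measurable_pi_apply i).aemeasurable
      (Measurable.of_discrete (f := fun t => ((h t : ℤ) : ℝ))).aestronglyMeasurable]

lemma integral_hashSum_sq :
    ∫ z, hashSum z ^ 2 ∂(groupLaw m τ) = m + m ^ 2 * ∑ t, τ.real {t} ^ 2 := by
  have hint := integrable_hashSum_sq m τ
  rw [groupLaw] at hint ⊢
  rw [integral_prod _ hint, ← integral_poisson_second]
  refine integral_congr_ae ?_
  filter_upwards [hint.prod_right_ae] with n hn
  rw [integral_prod _ hn]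
  simp_rw [(hashSum_moments_of_hash τ _ n).1]
  rw [integral_add (integrable_const _) (.of_finite), integral_const_mul,
    (hash_bias_moments _).1]
  simp

lemma integral_hashSum_pow_four_le :
    ∫ z, hashSum z ^ 4 ∂(groupLaw m τ) ≤ m + 3 * m ^ 2
      + (4 * m ^ 2 + 6 * m ^ 3) * (∑ t, τ.real {t} ^ 2)
      + m ^ 4 * (3 * (∑ t, τ.real {t} ^ 2) ^ 2) := by
  have hint := integrable_hashSum_pow_four m τ
  -- The fourth moment of the hash bias is the only quantity that is estimated; all else is an exact
  -- computation.
  refine le_trans (le_of_eq ?_) (add_le_add_right (mul_le_mul_of_nonneg_left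
    (hash_bias_moments fun t => τ.real {t}).2 (by positivity)) _)
  rw [groupLaw] at hint ⊢
  rw [integral_prod _ hint, ← integral_poisson_fourth]
  refine integral_congr_ae ?_
  filter_upwards [hint.prod_right_ae] with n hn
  rw [integral_prod _ hn]
  simp_rw [(hashSum_moments_of_hash τ _ n).2]
  rw [integral_add .of_finite .of_finite, integral_add (integrable_const _) .of_finite,
    integral_const_mul, integral_const_mul, (hash_bias_moments _).1]
  simp

lemma memLp_hashSum_sq : MemLp (fun z => hashSum z ^ 2) 2 (groupLaw m τ) := by
  rw [memLp_two_iff_integrable_sq (measurable_hashSum.pow_const 2).aestronglyMeasurable]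
  simpa only [← pow_mul] using integrable_hashSum_pow_four m τ

lemma variance_hashSum_sq_le :
    Var[fun z => hashSum z ^ 2; groupLaw m τ] ≤ m + 2 * m ^ 2
      + (4 * m ^ 2 + 4 * m ^ 3) * (∑ t, τ.real {t} ^ 2)
      + 2 * m ^ 4 * (∑ t, τ.real {t} ^ 2) ^ 2 := by
  rw [variance_eq_sub (memLp_hashSum_sq m τ), integral_hashSum_sq]
  simp only [Pi.pow_apply, ← pow_mul]
  linarith [integral_hashSum_pow_four_le m τ]

lemma measurable_collisionEstimate (r m : ℝ) :
    Measurable (collisionEstimate (T := T) r m) :=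
  (((measurable_hashSum.pow_const 2).sub_const m).const_mul r).div_const _

lemma memLp_collisionEstimate (r : ℝ) : MemLp (collisionEstimate r m) 2 (groupLaw m τ) := by
  rw [collisionEstimate_eq]
  exact ((memLp_hashSum_sq m τ).const_mul _).add (memLp_const _)

variable {m τ}

/-- Subtracting `m` removes the contribution of each user paired with itself, and `r / m ^ 2` undoes
the factor `m ^ 2 / r` of the distinct pairs. -/
lemma integral_collisionEstimate {r C : ℝ} (hr : 0 < r) (hm : 0 < m)
    (hτ : ∑ t, τ.real {t} ^ 2 = C / r) :
    ∫ z, collisionEstimate r m z ∂(groupLaw m τ) = C := by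
  have hm' : (0 : ℝ) < m := hm
  rw [collisionEstimate_eq, integral_add ((integrable_hashSum_sq m τ).const_mul _)
    (integrable_const _), integral_const_mul, integral_hashSum_sq, hτ]
  simp
  field_simp
  ring

lemma variance_collisionEstimate_le {r C : ℝ} (hr : 1 ≤ r) (hC : 0 < C) (hC1 : C ≤ 1)
    (hm : 3 * r / C ≤ m) (hτ : ∑ t, τ.real {t} ^ 2 = C / r) :
    Var[collisionEstimate r m; groupLaw m τ] ≤ 5 * C ^ 2 := by
  have hr0 : 0 < r := by linarith
  set M : ℝ := ↑m with hM
  have hm0 : 0 < M := lt_of_lt_of_le (by positivity) hm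
  rw [collisionEstimate_eq, variance_add_const
    ((measurable_hashSum.pow_const 2).const_mul _).aestronglyMeasurable, variance_const_mul]
  have h := variance_hashSum_sq_le m τ
  rw [hτ, ← hM] at h
  refine (mul_le_mul_of_nonneg_left h (sq_nonneg _)).trans ?_
  have hx : r / M ≤ C / 3 := by
    rw [div_le_iff₀ hC] at hm
    rw [div_le_div_iff₀ hm0 (by norm_num)]
    linarith
  set x := r / M with hxdef
  have hx0 : 0 < x := by positivity
  have hy : 1 / M ≤ x := by rw [hxdef]; gcongr
  set y := 1 / M with hydef
  have hy0 : 0 < y := by positivity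
  -- In terms of `x ≤ C / 3` and `y ≤ x ≤ 1 / 3`, every term is at most a multiple of `C ^ 2`; the
  -- multiples add up to just over 4.
  have e : (r / M ^ 2) ^ 2 * (M + 2 * M ^ 2 + (4 * M ^ 2 + 4 * M ^ 3) * (C / r)
      + 2 * M ^ 4 * (C / r) ^ 2) = x ^ 2 * y + 2 * x ^ 2 + 4 * C * x * y + 4 * C * x
        + 2 * C ^ 2 := by
    rw [hxdef, hydef]; field_simp; ring
  rw [e]
  have hx3 : x ≤ 1 / 3 := by linarith
  have h1 : x ^ 2 ≤ C ^ 2 / 9 := by nlinarith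
  have h2 : x ^ 2 * y ≤ C ^ 2 / 9 * (1 / 3) := by
    refine mul_le_mul h1 (by linarith) hy0.le (by positivity)
  have h3 : C * x ≤ C ^ 2 / 3 := by nlinarith
  have h4 : C * x * y ≤ C ^ 2 / 3 * (1 / 3) := by
    refine mul_le_mul h3 (by linarith) hy0.le (by positivity)
  nlinarith [sq_nonneg C]

end GroupModel

/-! ### Averaging within supergroups and concentration across them. -/

section Boosting

variable {Z : Type*} [MeasurableSpace Z] {ν : Measure Z} [IsProbabilityMeasure ν]

/-- Chebyshev's inequality for an average of independent copies of a random variable. -/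
lemma measureReal_abs_average_sub_gt_le {b : ℕ} (hb : 0 < b) {f : Z → ℝ} (hf : MemLp f 2 ν)
    {V ε : ℝ} (hV : Var[f; ν] ≤ V) (hε : 0 < ε) :
    (Measure.pi fun _ : Fin b => ν).real {z | ε < |1 / b * ∑ t, f (z t) - ∫ x, f x ∂ν|}
      ≤ V / (b * ε ^ 2) := by
  set P : Measure (Fin b → Z) := Measure.pi fun _ : Fin b => ν with hP
  have hfe (t : Fin b) : MemLp (fun z : Fin b → Z => f (z t)) 2 P :=
    hf.comp_measurePreserving (measurePreserving_eval (fun _ : Fin b => ν) t)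
  have hsum : MemLp (fun z : Fin b → Z => ∑ t, f (z t)) 2 P :=
    memLp_finsetSum _ fun t _ => hfe t
  have hX : MemLp (fun z : Fin b → Z => 1 / b * ∑ t, f (z t)) 2 P := hsum.const_mul _
  have hb' : (0 : ℝ) < b := by exact_mod_cast hb
  have hmean : ∫ z, (1 / b * ∑ t, f (z t)) ∂P = ∫ x, f x ∂ν := by
    rw [integral_const_mul, integral_finsetSum _ fun t _ => (hfe t).integrable one_le_two]
    have (t : Fin b) : ∫ z, f (z t) ∂P = ∫ x, f x ∂ν :=
      integral_comp_eval (μ := fun _ : Fin b => ν) (i := t) hf.1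
    simp_rw [this]
    simp [hb'.ne']
  have hvar : Var[fun z => 1 / b * ∑ t, f (z t); P] ≤ V / b := by
    rw [variance_const_mul]
    have h := variance_sum_pi (μ := fun _ : Fin b => ν) (X := fun _ => f) fun _ => hf
    have e : (∑ t : Fin b, fun z : Fin b → Z => f (z t)) = fun z => ∑ t, f (z t) := by
      ext z; simp
    rw [e, ← hP] at h
    rw [h, Finset.sum_const, Finset.card_univ, Fintype.card_fin, nsmul_eq_mul,
      div_pow, one_pow, div_mul_eq_mul_div, one_mul, div_le_div_iff₀ (by positivity) hb']
    nlinarith [mul_le_mul_of_nonneg_left hV (sq_nonneg (b : ℝ))]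
  have hcheb := meas_ge_le_variance_div_sq hX hε
  rw [hmean] at hcheb
  calc P.real {z | ε < |1 / b * ∑ t, f (z t) - ∫ x, f x ∂ν|}
      ≤ P.real {z | ε ≤ |1 / b * ∑ t, f (z t) - ∫ x, f x ∂ν|} :=
        measureReal_mono fun z (hz : ε < _) => hz.le
    _ ≤ Var[fun z => 1 / b * ∑ t, f (z t); P] / ε ^ 2 :=
        ENNReal.toReal_le_of_le_ofReal (div_nonneg (variance_nonneg _ _) (sq_nonneg _)) hcheb
    _ ≤ V / b / ε ^ 2 := by gcongr
    _ = V / (b * ε ^ 2) := div_div _ _ _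

open Classical in
/-- If each of `a` independent trials fails with probability at most `1 / 4`, then at least half
of them fail with probability at most `exp (-a / 8)`. -/
lemma measureReal_half_fail_le {a : ℕ} (ha : 0 < a) {E : Set Z} (hE : MeasurableSet E)
    (hν : ν.real E ≤ 1 / 4) :
    (Measure.pi fun _ : Fin a => ν).real
      {z | a ≤ 2 * (Finset.univ.filter fun ℓ => z ℓ ∈ E).card} ≤ Real.exp (-(a / 8)) := by
  set P : Measure (Fin a → Z) := Measure.pi fun _ : Fin a => ν with hP
  have ha' : (0 : ℝ) < a := by exact_mod_cast ha
  have hI : Measurable (E.indicator fun _ => (1 : ℝ)) := measurable_const.indicator hE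
  have hmean : ∫ x, E.indicator (fun _ => (1 : ℝ)) x ∂ν = ν.real E := by
    rw [integral_indicator_const _ hE]; simp
  have hind : iIndepFun (fun (ℓ : Fin a) (z : Fin a → Z) =>
      E.indicator (fun _ => (1 : ℝ)) (z ℓ) - ν.real E) P :=
    iIndepFun_pi (μ := fun _ : Fin a => ν)
      (X := fun _ x => E.indicator (fun _ => (1 : ℝ)) x - ν.real E)
      fun _ => (hI.sub_const _).aemeasurable
  -- Hoeffding's lemma: a variable with values in an interval of length 1 has variance proxy `(1 /
  -- 2) ^ 2`.
  have hsub (ℓ : Fin a) : HasSubgaussianMGF (fun z : Fin a → Z =>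
      E.indicator (fun _ => (1 : ℝ)) (z ℓ) - ν.real E) (1 / 4) P := by
    have h := hasSubgaussianMGF_of_mem_Icc (μ := P) (a := 0) (b := 1)
      (X := fun z : Fin a → Z => E.indicator (fun _ => (1 : ℝ)) (z ℓ))
      (hI.comp (measurable_pi_apply ℓ)).aemeasurable (.of_forall fun z => by
        by_cases hz : z ℓ ∈ E <;> simp [hz])
    have e : ∫ z, E.indicator (fun _ => (1 : ℝ)) (z ℓ) ∂P = ν.real E := by
      rw [← hmean]
      exact integral_comp_eval (μ := fun _ : Fin a => ν) (i := ℓ) hI.aestronglyMeasurable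
    rw [e] at h
    convert h using 1
    ext
    norm_num
  -- At least `a / 2` failures exceed the mean, at most `a / 4`, by `a / 4`. The exponent is `(a /
  -- 4) ^ 2 / (2 * (a / 4)) = a / 8`.
  have hoeff := HasSubgaussianMGF.measure_sum_ge_le_of_iIndepFun hind
    (s := Finset.univ) (fun ℓ _ => hsub ℓ) (ε := a / 4) (by positivity)
  refine (measureReal_mono fun z hz => ?_).trans (hoeff.trans (le_of_eq ?_))
  · have hz' : (a : ℝ) ≤ 2 * (Finset.univ.filter fun ℓ => z ℓ ∈ E).card := by exact_mod_cast hz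
    have hs : ∑ ℓ, E.indicator (fun _ => (1 : ℝ)) (z ℓ)
        = (Finset.univ.filter fun ℓ => z ℓ ∈ E).card := by
      simp [Set.indicator_apply, Finset.sum_boole]
    rw [Set.mem_ofPred_eq, Finset.sum_sub_distrib, hs]
    simp only [Finset.sum_const, Finset.card_univ, Fintype.card_fin, nsmul_eq_mul]
    nlinarith
  · congr 1
    simp
    field_simp
    norm_num

end Boosting

/-! ### Independence of the groups. -/

lemma measurePreserving_curry {ι κ X : Type*} [Fintype ι] [MeasurableSpace X]
    (μ : Measure X) [IsProbabilityMeasure μ] :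
    MeasurePreserving (MeasurableEquiv.curry ι κ X) (Measure.infinitePi fun _ : ι × κ => μ)
      (Measure.pi fun _ : ι => Measure.infinitePi fun _ : κ => μ) where
  measurable := (MeasurableEquiv.curry ι κ X).measurable
  map_eq := by
    rw [Measure.infinitePi_map_curry (fun (_ : ι) (_ : κ) => μ), Measure.infinitePi_eq_pi]

lemma measurePreserving_curry_pi {ι κ X : Type*} [Fintype ι] [Fintype κ] [MeasurableSpace X]
    (μ : Measure X) [IsProbabilityMeasure μ] :
    MeasurePreserving (MeasurableEquiv.curry ι κ X) (Measure.pi fun _ : ι × κ => μ)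
      (Measure.pi fun _ : ι => Measure.pi fun _ : κ => μ) := by
  simpa only [Measure.infinitePi_eq_pi] using measurePreserving_curry (ι := ι) (κ := κ) μ

lemma measurePreserving_arrowProd {γ α β : Type*} [Fintype γ] [MeasurableSpace α]
    [MeasurableSpace β] (μ : Measure α) (ν : Measure β) [SigmaFinite μ] [SigmaFinite ν] :
    MeasurePreserving (fun (y : (γ → α) × (γ → β)) j => (y.1 j, y.2 j))
      ((Measure.pi fun _ : γ => μ).prod (Measure.pi fun _ : γ => ν))
      (Measure.pi fun _ : γ => μ.prod ν) :=
  (measurePreserving_arrowProdEquivProdArrow α β γ (fun _ => μ) fun _ => ν).symm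

namespace MechanismParams

variable {M : MechanismParams} {k : ℕ}

/-- The distribution of the salt and the sample of one user. -/
noncomputable def inputLaw (M : MechanismParams) (p : PMF (Fin k)) : Measure (Fin M.r × Fin k) :=
  (PMF.uniformOfFintype (Fin M.r)).toMeasure.prod p.toMeasure

instance (p : PMF (Fin k)) : IsProbabilityMeasure (M.inputLaw p) := by
  unfold inputLaw; infer_instance

/-- The random choices made within each group, arranged by supergroup and group. -/
def groupData (ω : M.Run k) (ℓ : Fin M.a) (t : Fin M.b) :
    ℕ × (Fin M.r × Fin k → ℤˣ) × (ℕ → Fin M.r × Fin k) :=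
  (ω.1 (ℓ, t), fun x => ω.2.1 ((ℓ, t), x), fun i => ω.2.2 ((ℓ, t), i))

/-- Different groups read disjoint sets of hash values, so regrouping the coordinates of the product
measure exhibits i.i.d. groups. -/
lemma measurePreserving_groupData (p : PMF (Fin k)) :
    MeasurePreserving groupData (M.law p)
      (Measure.pi fun _ : Fin M.a => Measure.pi fun _ : Fin M.b =>
        groupLaw M.m.toNNReal (M.inputLaw p)) := by
  have hash := measurePreserving_curry_pi (ι := M.Group) (κ := Fin M.r × Fin k)
    (PMF.uniformOfFintype ℤˣ).toMeasure
  have users := measurePreserving_curry (ι := M.Group) (κ := ℕ) (M.inputLaw p)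
  have inner := (measurePreserving_arrowProd (γ := M.Group) _ _).comp (hash.prod users)
  have outer := (measurePreserving_arrowProd (γ := M.Group)
    (poissonMeasure M.m.toNNReal) _).comp ((MeasurePreserving.id _).prod inner)
  exact (measurePreserving_curry_pi (ι := Fin M.a) (κ := Fin M.b) _).comp outer

lemma groupEstimate_eq (ω : M.Run k) (ℓ : Fin M.a) (t : Fin M.b) :
    groupEstimate ω (ℓ, t) = collisionEstimate M.r M.m (groupData ω ℓ t) := by
  simp [groupEstimate, collisionEstimate, groupSum, hashSum, hashValue, groupData]

lemma supergroupEstimate_eq (ω : M.Run k) (ℓ : Fin M.a) :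
    supergroupEstimate ω ℓ
      = 1 / M.b * ∑ t, collisionEstimate M.r M.m (groupData ω ℓ t) := by
  simp only [supergroupEstimate, groupEstimate_eq]

/-- A uniform salt divides the collision probability by the number of salts. -/
lemma sum_inputLaw_sq (p : PMF (Fin k)) :
    ∑ x, (M.inputLaw p).real {x} ^ 2 = collisionProb p / M.r := by
  have hr : (M.r : ℝ) ≠ 0 := by exact_mod_cast M.r_pos.ne'
  have h (x : Fin M.r × Fin k) : (M.inputLaw p).real {x} ^ 2
      = (1 / (M.r : ℝ) ^ 2) * (p x.2).toReal ^ 2 := by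
    rw [inputLaw, ← Set.singleton_prod_singleton, measureReal_prod_prod, measureReal_def,
      measureReal_def, PMF.toMeasure_apply_singleton _ _ (.singleton _),
      PMF.toMeasure_apply_singleton _ _ (.singleton _)]
    simp [mul_pow]
  simp_rw [h]
  rw [Fintype.sum_prod_type]
  simp only [← Finset.mul_sum, Finset.sum_const, Finset.card_univ, Fintype.card_fin,
    nsmul_eq_mul]
  rw [collisionProb]
  field_simp

end MechanismParams

/-! ### The accuracy guarantee for large enough groups. -/

lemma PMF.sum_toReal {k : ℕ} (p : PMF (Fin k)) : ∑ i, (p i).toReal = 1 := by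
  have h := p.tsum_coe
  rw [tsum_fintype] at h
  rw [← ENNReal.toReal_sum fun i _ => p.apply_ne_top i, h, ENNReal.toReal_one]

lemma collisionProb_le_one {k : ℕ} (p : PMF (Fin k)) : collisionProb p ≤ 1 := by
  rw [← p.sum_toReal, collisionProb]
  refine Finset.sum_le_sum fun i _ => ?_
  have h1 : (p i).toReal ≤ 1 := ENNReal.toReal_le_of_le_ofReal one_pos.le (by
    simpa using p.coe_le_one i)
  have h0 : 0 ≤ (p i).toReal := ENNReal.toReal_nonneg
  nlinarith

lemma collisionProb_pos {k : ℕ} (p : PMF (Fin k)) : 0 < collisionProb p := by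
  obtain ⟨i, hi⟩ := p.support_nonempty
  have : 0 < (p i).toReal :=
    ENNReal.toReal_pos (by simpa using hi) (p.apply_ne_top i)
  exact lt_of_lt_of_le (pow_pos this 2) (Finset.single_le_sum
    (f := fun i => (p i).toReal ^ 2) (fun _ _ => sq_nonneg _) (Finset.mem_univ i))

namespace MechanismParams

lemma one_sub_delta_le_measureReal (M : MechanismParams) {k : ℕ} (p : PMF (Fin k)) {ε : ℝ}
    (hδ : M.δ < 1) (hε : M.εrel = ε / collisionProb p)
    (hm : 3 * M.r / collisionProb p ≤ M.m) :
    1 - M.δ ≤ (M.law p).real {ω | |estimate ω - collisionProb p| ≤ ε} := by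
  classical
  set C := collisionProb p with hC
  have hC0 : 0 < C := collisionProb_pos p
  have hr : (1 : ℝ) ≤ M.r := by exact_mod_cast M.r_pos
  have hm0 : 0 < M.m := lt_of_lt_of_le (by positivity) hm
  have hε0 : 0 < ε := by
    have := M.εrel_pos
    rw [hε] at this
    exact (div_pos_iff_of_pos_right hC0).1 this
  have hεC : ε = M.εrel * C := by rw [hε]; field_simp
  have hlog : 0 < Real.log (1 / M.δ) := Real.log_pos (by rw [lt_div_iff₀ M.δ_pos]; linarith)
  -- This needs `δ < 1`: for `δ = 1` there are no supergroups and the median is its default value 0.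
  have ha : 0 < M.a := Nat.ceil_pos.2 (by positivity)
  have hb : 0 < M.b := Nat.ceil_pos.2 (by have := M.εrel_pos; positivity)
  have hb20 : 20 / M.εrel ^ 2 ≤ M.b := Nat.le_ceil _
  set ν := groupLaw M.m.toNNReal (M.inputLaw p) with hν
  have hcoe : ((M.m.toNNReal : NNReal) : ℝ) = M.m := Real.coe_toNNReal _ hm0.le
  have hmean : ∫ z, collisionEstimate M.r M.m z ∂ν = C := by
    have := integral_collisionEstimate (m := M.m.toNNReal) (τ := M.inputLaw p) (r := M.r)
      (by linarith) (by simpa using hm0) (sum_inputLaw_sq p)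
    rwa [hcoe] at this
  have hvar : Var[collisionEstimate M.r M.m; ν] ≤ 5 * C ^ 2 := by
    have := variance_collisionEstimate_le (m := M.m.toNNReal) (τ := M.inputLaw p) (r := M.r)
      hr hC0 (collisionProb_le_one p) (by rwa [hcoe]) (sum_inputLaw_sq p)
    rwa [hcoe] at this
  have hLp : MemLp (collisionEstimate M.r M.m) 2 ν := by
    have := memLp_collisionEstimate M.m.toNNReal (M.inputLaw p) M.r
    rwa [hcoe] at this
  set E : Set (Fin M.b → ℕ × (Fin M.r × Fin k → ℤˣ) × (ℕ → Fin M.r × Fin k)) :=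
    {z | ε < |1 / M.b * ∑ t, collisionEstimate M.r M.m (z t) - C|} with hEdef
  have hE : MeasurableSet E := by
    refine measurableSet_lt measurable_const (Measurable.abs (Measurable.sub_const ?_ _))
    exact (Finset.measurable_fun_sum _ fun t _ =>
      (measurable_collisionEstimate _ _).comp (measurable_pi_apply t)).const_mul _
  -- Chebyshev gives `5 C² / (b ε²)`, and `b ε² ≥ 20 C²` because `ε = εrel C`.
  have hE4 : (Measure.pi fun _ : Fin M.b => ν).real E ≤ 1 / 4 := by
    have h := measureReal_abs_average_sub_gt_le hb hLp hvar hε0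
    rw [hmean] at h
    refine h.trans ?_
    have hεr := M.εrel_pos
    rw [div_le_iff₀ (by positivity)] at hb20
    rw [div_le_div_iff₀ (by positivity) (by norm_num), hεC]
    nlinarith [mul_le_mul_of_nonneg_right hb20 (sq_nonneg C)]
  set F := {z : Fin M.a → Fin M.b → ℕ × (Fin M.r × Fin k → ℤˣ) × (ℕ → Fin M.r × Fin k) |
    M.a ≤ 2 * (Finset.univ.filter fun ℓ => z ℓ ∈ E).card} with hFdef
  have hF : MeasurableSet F := by
    have hcard : Measurable fun z : Fin M.a → Fin M.b →
        ℕ × (Fin M.r × Fin k → ℤˣ) × (ℕ → Fin M.r × Fin k) =>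
        ∑ ℓ, if z ℓ ∈ E then 1 else 0 :=
      Finset.measurable_fun_sum _ fun ℓ _ =>
        Measurable.ite (measurable_pi_apply ℓ hE) measurable_const measurable_const
    have := measurableSet_le (measurable_const (a := M.a)) (hcard.const_mul 2)
    simpa only [hFdef, Finset.card_filter] using this
  have hfail : (M.law p).real (groupData ⁻¹' F) ≤ M.δ := by
    rw [(measurePreserving_groupData p).measureReal_preimage hF.nullMeasurableSet]
    refine (measureReal_half_fail_le ha hE hE4).trans ?_
    have h8 : 8 * Real.log (1 / M.δ) ≤ M.a := Nat.le_ceil _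
    rw [← Real.le_log_iff_exp_le M.δ_pos]
    rw [one_div, Real.log_inv] at h8
    linarith
  have hprob : IsProbabilityMeasure (M.law p) := by unfold law; infer_instance
  calc 1 - M.δ ≤ (M.law p).real (groupData ⁻¹' F)ᶜ := by
        rw [probReal_compl_eq_one_sub ((measurePreserving_groupData p).measurable hF)]
        linarith
    -- Only an inclusion of events is used, so measurability of the median is not needed.
    _ ≤ _ := measureReal_mono fun ω hω => by
        refine abs_finMedian_sub_le ha _ _ _ ?_
        simp only [supergroupEstimate_eq]
        simpa [hFdef, hEdef] using hω

end MechanismParams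

/-! ### Bounds on the rounded parameters, and the conclusion. -/

namespace MechanismParams

variable (M : MechanismParams)

/-- Here `(e^α + 1) / (e^α - 1) ≤ 4 / α`, whence `96 = 6 · 16`. The additive constants `log 4 ≤ 2`
and the 1 from rounding are absorbed using `1 ≤ log (1 / β) / log (1 / β₀)`, whence `193 = 96 · 2 +
1`; this is where `β₀ < 1` enters. -/
lemma r_le {β₀ : ℝ} (hβ₀ : β₀ < 1) (hα : M.α ≤ 1) (hβ : M.β ≤ β₀) :
    M.r ≤ (96 + 193 / Real.log (1 / β₀)) * (Real.log (1 / M.β) / M.α ^ 2) := by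
  have hα0 := M.α_pos
  have hβpos := M.β_pos
  have hβ₀pos : 0 < β₀ := hβpos.trans_le hβ
  have hL0 : 0 < Real.log (1 / β₀) := Real.log_pos (by rw [lt_div_iff₀ hβ₀pos]; linarith)
  have hL : Real.log (1 / β₀) ≤ Real.log (1 / M.β) :=
    Real.log_le_log (by positivity) (one_div_le_one_div_of_le hβpos hβ)
  have hlog4 : Real.log 4 ≤ 2 := by
    rw [show (4 : ℝ) = 2 ^ 2 by norm_num, Real.log_pow]
    have := Real.log_two_lt_d9
    push_cast; linarith
  have hsplit : Real.log (4 / M.β) = Real.log 4 + Real.log (1 / M.β) := by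
    rw [← Real.log_mul (by norm_num) (by positivity)]; congr 1; ring
  have hexp : M.α ≤ Real.exp M.α - 1 := by linarith [Real.add_one_le_exp M.α]
  have hexp3 : Real.exp M.α + 1 ≤ 4 := by
    have h1 := Real.exp_le_exp.2 hα
    have := Real.exp_one_lt_d9
    linarith
  have hexppos := Real.exp_pos M.α
  have hratio : (Real.exp M.α + 1) / (Real.exp M.α - 1) ≤ 4 / M.α :=
    div_le_div₀ (by norm_num) hexp3 hα0 hexp
  have hratio0 : 0 ≤ (Real.exp M.α + 1) / (Real.exp M.α - 1) :=
    div_nonneg (by positivity) (by linarith)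
  have hsq : ((Real.exp M.α + 1) / (Real.exp M.α - 1)) ^ 2 ≤ 16 / M.α ^ 2 := by
    refine (pow_le_pow_left₀ hratio0 hratio 2).trans_eq ?_
    rw [div_pow]; norm_num
  set L₀ := Real.log (1 / β₀)
  set L := Real.log (1 / M.β)
  have hL' : 0 < L := hL0.trans_le hL
  have h1 : 1 ≤ L / L₀ := (one_le_div hL0).2 hL
  have hα2 : 1 ≤ 1 / M.α ^ 2 := (one_le_div (by positivity)).2 (pow_le_one₀ hα0.le hα)
  have hlog : Real.log (4 / M.β) ≤ 2 * (L / L₀) + L := by rw [hsplit]; linarith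
  have hlog0 : 0 ≤ Real.log (4 / M.β) := Real.log_nonneg (by
    rw [le_div_iff₀ hβpos]; linarith [M.β_le_one])
  have hceil := (Nat.ceil_lt_add_one
    (a := 6 * ((Real.exp M.α + 1) / (Real.exp M.α - 1)) ^ 2 * Real.log (4 / M.β))
    (by positivity)).le
  calc (M.r : ℝ) ≤ 6 * ((Real.exp M.α + 1) / (Real.exp M.α - 1)) ^ 2 * Real.log (4 / M.β) + 1 :=
        hceil
    _ ≤ 6 * (16 / M.α ^ 2) * (2 * (L / L₀) + L) + (1 / M.α ^ 2) * (L / L₀) := by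
        gcongr
        nlinarith
    _ = (96 + 193 / L₀) * (L / M.α ^ 2) := by field_simp; ring

lemma a_le {δ₀ : ℝ} (hδ₀ : δ₀ < 1) (hδ : M.δ ≤ δ₀) :
    M.a ≤ (8 + 1 / Real.log (1 / δ₀)) * Real.log (1 / M.δ) := by
  have hδpos := M.δ_pos
  have hδ₀pos : 0 < δ₀ := hδpos.trans_le hδ
  have hL0 : 0 < Real.log (1 / δ₀) := Real.log_pos (by rw [lt_div_iff₀ hδ₀pos]; linarith)
  have hL : Real.log (1 / δ₀) ≤ Real.log (1 / M.δ) :=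
    Real.log_le_log (by positivity) (one_div_le_one_div_of_le hδpos hδ)
  have h1 := (one_le_div hL0).2 hL
  calc (M.a : ℝ) ≤ 8 * Real.log (1 / M.δ) + 1 :=
        (Nat.ceil_lt_add_one (mul_nonneg (by norm_num) (hL0.le.trans hL))).le
    _ ≤ 8 * Real.log (1 / M.δ) + Real.log (1 / M.δ) / Real.log (1 / δ₀) := by gcongr
    _ = _ := by ring

lemma b_le : M.b ≤ 21 / M.εrel ^ 2 := by
  have hε := M.εrel_pos
  have h1 : 1 ≤ 1 / M.εrel ^ 2 :=
    (one_le_div (by positivity)).2 (pow_le_one₀ hε.le M.εrel_le_one)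
  calc (M.b : ℝ) ≤ 20 / M.εrel ^ 2 + 1 := (Nat.ceil_lt_add_one (by positivity)).le
    _ ≤ 20 / M.εrel ^ 2 + 1 / M.εrel ^ 2 := by gcongr
    _ = _ := by ring

end MechanismParams

theorem corollary1 (β₀ δ₀ : ℝ) (hβ₀ : β₀ < 1) (hδ₀ : δ₀ < 1) :
    ∃ K : ℝ, 0 < K ∧
      ∀ (k : ℕ) (p : PMF (Fin k)) (M : MechanismParams) (ε : ℝ),
        M.α ≤ 1 → M.β ≤ β₀ → M.δ ≤ δ₀ →
        M.εrel = ε / collisionProb p →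
        K * (collisionProb p * Real.log (1 / M.β) * Real.log (1 / M.δ) / (M.α ^ 2 * ε ^ 2)) ≤ M.n →
        1 - M.δ ≤ (M.law p).real {ω | |MechanismParams.estimate ω - collisionProb p| ≤ ε} := by
  -- If `β₀` or `δ₀` is not positive, no parameters qualify and any `K` works.
  by_cases hpos : 0 < β₀ ∧ 0 < δ₀
  swap
  · refine ⟨1, one_pos, fun k p M ε _ hβ hδ => ?_⟩
    exact absurd ⟨M.β_pos.trans_le hβ, M.δ_pos.trans_le hδ⟩ hpos
  obtain ⟨hβ₀pos, hδ₀pos⟩ := hpos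
  have hLβ : 0 < Real.log (1 / β₀) := Real.log_pos (by rw [lt_div_iff₀ hβ₀pos]; linarith)
  have hLδ : 0 < Real.log (1 / δ₀) := Real.log_pos (by rw [lt_div_iff₀ hδ₀pos]; linarith)
  -- The factor `63 = 3 · 21` combines the 3 in `m ≥ 3 r / C` with the 21 of `b_le`; the other
  -- factors come from `r_le` and `a_le`.
  refine ⟨63 * (96 + 193 / Real.log (1 / β₀)) * (8 + 1 / Real.log (1 / δ₀)), by positivity,
    fun k p M ε hα hβ hδ hε hn => ?_⟩
  have hC := collisionProb_pos p
  refine M.one_sub_delta_le_measureReal p (hδ.trans_lt hδ₀) hε ?_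
  have hεrel := M.εrel_pos
  have hαpos := M.α_pos
  have hδ1 : M.δ < 1 := hδ.trans_lt hδ₀
  have hLM : 0 < Real.log (1 / M.δ) := Real.log_pos (by rw [lt_div_iff₀ M.δ_pos]; linarith)
  have ha : (0 : ℝ) < M.a := by
    exact_mod_cast (Nat.ceil_pos.2 (by positivity) : 0 < M.a)
  have hb : (0 : ℝ) < M.b := by
    exact_mod_cast (Nat.ceil_pos.2 (by positivity) : 0 < M.b)
  have hε' : ε = M.εrel * collisionProb p := by rw [hε]; field_simp
  rw [MechanismParams.m, MechanismParams.g, Nat.cast_mul, le_div_iff₀ (by positivity)]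
  refine le_trans ?_ hn
  have hr0 : (0 : ℝ) ≤ M.r := Nat.cast_nonneg _
  have h := mul_le_mul (mul_le_mul (M.r_le hβ₀ hα hβ) (M.a_le hδ₀ hδ) ha.le
    (hr0.trans (M.r_le hβ₀ hα hβ))) M.b_le hb.le
    (mul_nonneg (hr0.trans (M.r_le hβ₀ hα hβ)) (ha.le.trans (M.a_le hδ₀ hδ)))
  calc 3 * (M.r : ℝ) / collisionProb p * (M.a * M.b)
      = 3 / collisionProb p * (M.r * M.a * M.b) := by ring
    _ ≤ 3 / collisionProb p * _ := mul_le_mul_of_nonneg_left h (by positivity)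
    _ = _ := by rw [hε']; field_simp; ring
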